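/- **Model.** A ring of $n\ge 1$ nodes is a cycle on $n$ nodes (for $n=2$ with a double edge, for $n=1$ a loop); each node is attached to its two incident edge ends by ports, called Port 0 and Port 1, assigned arbitrarily and independently of any direction of the ring. The ring is anonymous: all nodes are identical, have no IDs, do not know $n$ or any bound on it, and run the same algorithm; each node has its own, independent infinite sequence of fair coin flips. Messages have no content (pulses). A node acts once at the beginning and afterwards only upon receiving a pulse; as a function of its coin flips (almost surely, finitely many of them for each action) and of the sequence of ports at which it has received pulses so far, it may send any finite number of pulses through each port, and it updates its output: a decision Leader or Non-Leader (or none yet), and a label "clockwise" on one of its ports (or none yet); it may also enter a terminating state, after which it ignores all pulses. The network is asynchronous: pulses are neither lost nor created, and as long as pulses are in transit, an arbitrary one of them is delivered next; a rule for choosing it is a schedule. The network is quiescent when no pulse is in transit. The clockwise labels orient the ring if, starting from any node and moving repeatedly through the port labelled clockwise, one passes through all edges. **Theorem.** For every real $c>0$ there are such a randomized content-oblivious algorithm (not depending on $n$) and constants $C$ and $k$ such that for every $n\ge 1$ and every assignment of ports in the anonymous ring of $n$ nodes: 1. with probability at least $1-C\,n^{-c}$ over the coin flips, the following holds under every schedule: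 the network reaches quiescence after at most $C\,n^{k}$ pulses have been sent in total, and then exactly one node has output Leader, all other nodes have output Non-Leader, and the clockwise labels of the nodes orient the ring; 2. with probability $1$, the network reaches quiescence under every schedule; 3. the algorithm does not terminate: no node ever enters a terminating state. -/

import Mathlib

open MeasureTheory

namespace ContentOblivious

noncomputable section

/-- The two ports of a node: `false` is Port 0 and `true` is Port 1. -/
abbrev Port := Bool

/-! ### Randomness -/

/-- The private random source of one node: an infinite sequence of coin flips. -/
abbrev Tape := ℕ → Bool

/-- The law of one fair coin flip. -/
def fairCoin : Measure Bool := (PMF.uniformOfFintype Bool).toMeasure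

instance : IsProbabilityMeasure fairCoin := by
  unfold fairCoin; infer_instance

/-- The law of a tape: independent fair coin flips. -/
def tapeLaw : Measure Tape := Measure.infinitePi (fun _ : ℕ => fairCoin)

instance : IsProbabilityMeasure tapeLaw := by
  unfold tapeLaw; infer_instance

/-- The joint law of the tapes of the `n` nodes: independent tapes. -/
def ringLaw (n : ℕ) [NeZero n] : Measure (ZMod n → Tape) :=
  Measure.pi (fun _ : ZMod n => tapeLaw)

/-! ### Content-oblivious algorithms for identical nodes -/

/-- The possible decisions of a node in leader election. -/
inductive Role
  | leader
  | nonLeader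

/-- What a node does when it is activated: the number of pulses it sends through each port, and
its state afterwards as far as it is visible: its current decision (if any), the port it currently
labels as clockwise (if any), and whether it has entered a terminating state. -/
structure Action where
  send : Port → ℕ
  role : Option Role
  cwPort : Option Port
  terminated : Bool

/-- A randomized, uniform, event-driven content-oblivious algorithm, run by every node of an
anonymous network. `act ω h` is the action of a node with tape `ω` at the moment when the
sequence of ports at which it has received pulses so far is `h`, latest first; `act ω []` is its
action at the very beginning. Nothing else (an ID, the number of nodes, a message content, the
time) is available to the node. Every action uses, almost surely, finitely many coin flips. -/
structure Algorithm where
  act : Tape → List Port → Action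
  finitely_many_coins : ∀ h : List Port, ∀ᵐ ω ∂tapeLaw,
    ∃ k : ℕ, ∀ ω' : Tape, (∀ i < k, ω' i = ω i) → act ω' h = act ω h

/-! ### Rings

The nodes of a ring of size `n` are the elements of `ZMod n`, and `v` is joined to `v + 1` by an
edge (two nodes are joined by two parallel edges, a single node has a loop). The assignment of
ports is arbitrary: `o v` is the port of `v` on the edge from `v` to `v + 1`, and `!o v` is its
port on the edge from `v - 1` to `v`. -/

/-- The other end of the edge that is attached to port `x.2` of node `x.1`. -/
def link {n : ℕ} (o : ZMod n → Port) (x : ZMod n × Port) : ZMod n × Port :=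
  if x.2 = o x.1 then (x.1 + 1, !o (x.1 + 1)) else (x.1 - 1, o (x.1 - 1))

/-- The labelling `cw` of one port of each node as clockwise is a consistent orientation:
from every node, moving repeatedly through the port labelled clockwise passes through all edges
of the ring. An edge is represented by any of its two ends `x` and `link o x`. -/
def IsOrientation {n : ℕ} (o : ZMod n → Port) (cw : ZMod n → Port) : Prop :=
  ∀ (s : ZMod n) (x : ZMod n × Port), ∃ k : ℕ,
    let v := (fun u => (link o (u, cw u)).1)^[k] s
    x = (v, cw v) ∨ x = link o (v, cw v)

/-! ### Asynchronous executions -/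

/-- A configuration: the pulses that each node has processed so far, the number of pulses in
transit towards each port of each node, and the total number of pulses sent so far. -/
structure Config (n : ℕ) where
  hist : ZMod n → List Port
  transit : ZMod n × Port → ℕ
  sent : ℕ

/-- No pulse is in transit. -/
def Config.Quiescent {n : ℕ} (s : Config n) : Prop := ∀ x, s.transit x = 0

namespace Algorithm

variable {n : ℕ} [NeZero n]

/-- The latest action of node `v` in the configuration `s`. -/
def current (A : Algorithm) (ω : ZMod n → Tape) (s : Config n) (v : ZMod n) : Action :=
  A.act (ω v) (s.hist v)

/-- The configuration after every node has acted once at the beginning. -/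
def start (A : Algorithm) (o : ZMod n → Port) (ω : ZMod n → Tape) : Config n where
  hist := fun _ => []
  transit := fun x => (A.act (ω (link o x).1) []).send (link o x).2
  sent := ∑ v, ∑ q, (A.act (ω v) []).send q

/-- One pulse in transit towards port `p` of node `v` is delivered and `v` reacts to it.
A node in a terminating state ignores the pulse. -/
def deliver (A : Algorithm) (o : ZMod n → Port) (ω : ZMod n → Tape) (s : Config n)
    (v : ZMod n) (p : Port) : Config n :=
  let rest : ZMod n × Port → ℕ := Function.update s.transit (v, p) (s.transit (v, p) - 1)
  if (A.current ω s v).terminated then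
    { s with transit := rest }
  else
    let a := A.act (ω v) (p :: s.hist v)
    { hist := Function.update s.hist v (p :: s.hist v)
      transit := fun x => rest x + if (link o x).1 = v then a.send (link o x).2 else 0
      sent := s.sent + ∑ q, a.send q }

/-- `e` is a (maximal) execution: as long as some pulse is in transit, one such pulse,
chosen arbitrarily by the asynchronous network, is delivered next. -/
def IsExecution (A : Algorithm) (o : ZMod n → Port) (ω : ZMod n → Tape) (e : ℕ → Config n) :
    Prop :=
  e 0 = A.start o ω ∧
  ∀ t, (∃ v p, 0 < (e t).transit (v, p) ∧ e (t + 1) = A.deliver o ω (e t) v p) ∨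
    ((e t).Quiescent ∧ e (t + 1) = e t)

/-- Exactly one node has decided to be the leader, and all the others not to be. -/
def ElectsLeader (A : Algorithm) (ω : ZMod n → Tape) (s : Config n) : Prop :=
  ∃ l : ZMod n, (A.current ω s l).role = some Role.leader ∧
    ∀ v, v ≠ l → (A.current ω s v).role = some Role.nonLeader

/-- Every node labels one of its ports as clockwise, and this orients the ring. -/
def OrientsRing (A : Algorithm) (o : ZMod n → Port) (ω : ZMod n → Tape) (s : Config n) : Prop :=
  ∃ cw : ZMod n → Port, (∀ v, (A.current ω s v).cwPort = some (cw v)) ∧ IsOrientation o cw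

/-- In the execution `e` the network reaches quiescence after at most `B` pulses have been sent
in total, with a leader elected and the ring oriented. (A quiescent configuration does not change
any more, so these are the final outputs and the total number of pulses.) -/
def Succeeds (A : Algorithm) (o : ZMod n → Port) (ω : ZMod n → Tape) (e : ℕ → Config n)
    (B : ℝ) : Prop :=
  ∃ t, (e t).Quiescent ∧ ((e t).sent : ℝ) ≤ B ∧ A.ElectsLeader ω (e t) ∧ A.OrientsRing o ω (e t)

end Algorithm

end

end ContentOblivious

/-!
Every node draws a random identifier from its coin flips: the number whose binary digits are a
prefix of the tape of length `K` times a geometric random variable. The largest of `n` geometric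
variables is about `log n`, so with high probability the largest identifier has `Θ(K log n)` random
bits; then it is polynomial in `n`, and unlikely to be attained twice.

A node with identifier `i` uses `2 i + 1` at Port 0 and `2 i + 2` at Port 1. In each direction of
the ring it sends one pulse and forwards all the pulses it receives, except that it absorbs the one
whose number is its identifier at the receiving port. As pulses are neither lost nor created, at
quiescence the counters of a direction agree all around the ring, and every node has absorbed
its pulse; hence all counters equal the largest identifier used in that direction. If the
largest `i` belongs to a single node, these two values are `2 i + 1` and `2 i + 2`: their
difference tells the two directions apart consistently, and only that node recognizes the larger
one as its own.
-/

namespace ContentOblivious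

open ProbabilityTheory
open scoped ENNReal

/-- The number of pulses that a node acting by `act` has sent through each port, in total, by the
time its history is `h`, provided that it has not terminated. -/
def totalSent (act : List Port → Action) : List Port → Port → ℕ
  | [], q => (act []).send q
  | p :: h, q => totalSent act h q + (act (p :: h)).send q

lemma totalSent_update {ι : Type*} [DecidableEq ι] (act : ι → List Port → Action)
    (hist : ι → List Port) (v u : ι) (p q : Port) :
    totalSent (act u) (Function.update hist v (p :: hist v) u) q =
      totalSent (act u) (hist u) q + if u = v then (act v (p :: hist v)).send q else 0 := by
  by_cases huv : u = v
  · subst huv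
    simp [totalSent]
  · simp [huv]

namespace Algorithm

/-- No node running `A` ever enters a terminating state, whatever its coin flips and its history
are. -/
def NeverTerminates (A : Algorithm) : Prop := ∀ ω h, (A.act ω h).terminated = false

variable {n : ℕ} {A : Algorithm} {o : ZMod n → Port} {ω : ZMod n → Tape}

lemma deliver_eq (hA : A.NeverTerminates) (s : Config n) (v : ZMod n) (p : Port) :
    A.deliver o ω s v p =
      { hist := Function.update s.hist v (p :: s.hist v)
        transit := fun x => Function.update s.transit (v, p) (s.transit (v, p) - 1) x +
          if (link o x).1 = v then (A.act (ω v) (p :: s.hist v)).send (link o x).2 else 0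
        sent := s.sent + ∑ q, (A.act (ω v) (p :: s.hist v)).send q } := by
  simp [deliver, current, hA _ _]

lemma update_transit_add_count {s : Config n} {v : ZMod n} {p : Port}
    (hp : 0 < s.transit (v, p)) (x : ZMod n × Port) :
    Function.update s.transit (v, p) (s.transit (v, p) - 1) x +
        (Function.update s.hist v (p :: s.hist v) x.1).count x.2 =
      s.transit x + (s.hist x.1).count x.2 := by
  obtain ⟨u, q⟩ := x
  rcases eq_or_ne u v with rfl | hu
  · rcases eq_or_ne q p with rfl | hq
    · simp only [Function.update_self, List.count_cons_self]
      omega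
    · simp [hq, hq.symm]
  · simp [hu]

namespace IsExecution

variable [NeZero n] {e : ℕ → Config n}

lemma induction {P : Config n → Prop} (he : A.IsExecution o ω e) (start : P (A.start o ω))
    (deliver : ∀ s v p, 0 < s.transit (v, p) → P s → P (A.deliver o ω s v p)) (t : ℕ) :
    P (e t) := by
  induction t with
  | zero => exact he.1 ▸ start
  | succ t ih =>
    rcases he.2 t with ⟨v, p, hp, h⟩ | ⟨-, h⟩
    · exact h ▸ deliver _ v p hp ih
    · exact h ▸ ih

lemma transit_add_count (hA : A.NeverTerminates) (he : A.IsExecution o ω e) (t : ℕ)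
    (x : ZMod n × Port) :
    (e t).transit x + ((e t).hist x.1).count x.2 =
      totalSent (A.act (ω (link o x).1)) ((e t).hist (link o x).1) (link o x).2 := by
  refine he.induction (P := fun s => s.transit x + (s.hist x.1).count x.2 =
    totalSent (A.act (ω (link o x).1)) (s.hist (link o x).1) (link o x).2) ?_ ?_ t
  · simp [start, totalSent]
  · intro s v p hp ih
    rw [deliver_eq hA, totalSent_update (fun u => A.act (ω u)), ← ih,
      ← update_transit_add_count hp x, add_right_comm]

lemma sent_eq (hA : A.NeverTerminates) (he : A.IsExecution o ω e) (t : ℕ) :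
    (e t).sent = ∑ v, ∑ q, totalSent (A.act (ω v)) ((e t).hist v) q := by
  refine he.induction (P := fun s => s.sent = ∑ v, ∑ q, totalSent (A.act (ω v)) (s.hist v) q)
    rfl ?_ t
  intro s v p _ ih
  rw [deliver_eq hA]
  simp only [totalSent_update (fun u => A.act (ω u)), Finset.sum_add_distrib, ih]
  rw [Finset.sum_comm (f := fun u q => ite (u = v) _ _)]
  simp

lemma count_hist_succ_le (hA : A.NeverTerminates) (he : A.IsExecution o ω e) (t : ℕ)
    (x : ZMod n × Port) :
    ((e (t + 1)).hist x.1).count x.2 ≤ (e t).transit x + ((e t).hist x.1).count x.2 := by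
  rcases he.2 t with ⟨v, p, hp, h⟩ | ⟨-, h⟩
  · rw [h, deliver_eq hA, ← update_transit_add_count hp x]
    exact Nat.le_add_left _ _
  · exact h ▸ Nat.le_add_left _ _

lemma sum_length_hist (hA : A.NeverTerminates) (he : A.IsExecution o ω e)
    (hne : ∀ t, ¬ (e t).Quiescent) (t : ℕ) : ∑ v, ((e t).hist v).length = t := by
  induction t with
  | zero => simp [he.1, start]
  | succ t ih =>
    obtain ⟨u, p, -, h⟩ := (he.2 t).resolve_right fun h => hne t h.1
    have hlen (v) : (Function.update (e t).hist u (p :: (e t).hist u) v).length =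
        ((e t).hist v).length + if v = u then 1 else 0 := by
      rcases eq_or_ne v u with rfl | hv
      · simp
      · simp [hv]
    simp [h, deliver_eq hA, hlen, Finset.sum_add_distrib, ih]

lemma exists_quiescent_of_length_hist_le (hA : A.NeverTerminates) (he : A.IsExecution o ω e)
    {m : ℕ} (hm : ∀ t v, ((e t).hist v).length ≤ m) : ∃ t, (e t).Quiescent := by
  by_contra! hne
  have hle : n * m + 1 ≤ n * m := by
    calc n * m + 1 = ∑ v, ((e (n * m + 1)).hist v).length := (he.sum_length_hist hA hne _).symm
      _ ≤ ∑ _v : ZMod n, m := Finset.sum_le_sum fun v _ => hm _ v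
      _ = n * m := by simp [ZMod.card]
  omega

end IsExecution

end Algorithm

section Direction

variable {n : ℕ} (o : ZMod n → Port)

/-- The port at which node `v` receives the pulses moving in direction `b`, where `true` stands
for the direction from `v` to `v + 1`. -/
def inPort (b : Bool) (v : ZMod n) : Port := xor b (o v)

/-- The node from which each node receives the pulses moving in direction `b`. -/
def upstream (b : Bool) : Equiv.Perm (ZMod n) :=
  Equiv.addRight (if b then -1 else 1)

lemma inPort_not (b : Bool) (v : ZMod n) : inPort o (!b) v = !inPort o b v := Bool.not_xor ..

lemma exists_inPort_eq (v : ZMod n) (p : Port) : ∃ b, inPort o b v = p :=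
  ⟨xor p (o v), by simp [inPort]⟩

lemma link_inPort (b : Bool) (v : ZMod n) :
    link o (v, inPort o b v) = (upstream b v, !inPort o b (upstream b v)) := by
  cases b <;> simp [link, inPort, upstream, sub_eq_add_neg]

lemma link_not_inPort (b : Bool) (v : ZMod n) :
    link o (v, !inPort o b v) = ((upstream b).symm v, inPort o b ((upstream b).symm v)) := by
  cases b <;> simp [link, inPort, upstream, sub_eq_add_neg]

lemma exists_iterate_upstream_eq [NeZero n] (b : Bool) (u v : ZMod n) :
    ∃ k : ℕ, (upstream b)^[k] u = v := by
  cases b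
  · exact ⟨(v - u).val, by simp [upstream]⟩
  · exact ⟨(u - v).val, by simp [upstream]⟩

lemma isOrientation_not_inPort [NeZero n] (b : Bool) :
    IsOrientation o (fun v => !inPort o b v) := by
  have hstep : (fun u => (link o (u, !inPort o b u)).1) = upstream (!b) := by
    ext u
    rw [← inPort_not, link_inPort]
  rintro s ⟨w, p⟩
  rw [hstep]
  by_cases hp : p = inPort o b w
  · obtain ⟨k, hk⟩ := exists_iterate_upstream_eq (!b) s (upstream b w)
    exact ⟨k, Or.inr (by simp only [hk, link_not_inPort, Equiv.symm_apply_apply, hp])⟩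
  · obtain ⟨k, hk⟩ := exists_iterate_upstream_eq (!b) s w
    exact ⟨k, Or.inl (by simp only [hk, Bool.eq_not_of_ne hp])⟩

end Direction

section PulseCounting

/-- The identifier that a node with identifier `i` uses for the pulses arriving at port `p`.
Identifiers at different ports differ, and they are positive. -/
def portId (i : ℕ) (p : Port) : ℕ := 2 * i + p.toNat + 1

/-- The number of pulses that a node has sent on in one direction, its initial pulse included,
after it has received `r` pulses from that direction and absorbed the `k`-th of them. -/
def forwarded (k r : ℕ) : ℕ := if r < k then r + 1 else r

/-- The action of a node with identifier `i` in the pulse-counting algorithm: it sends one pulse in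
each direction, then forwards all pulses except the `portId i p`-th one received at port `p`. A node
considers itself the leader when the larger of its two counters equals its larger identifier, and
takes the pulses counted there to move clockwise. -/
def countingAct (i : ℕ) (h : List Port) : Action where
  send q := match h with
    | [] => 1
    | p :: _ => if q = !p ∧ h.count p ≠ portId i p then 1 else 0
  role := if max (h.count false) (h.count true) = portId i true then some Role.leader
    else some Role.nonLeader
  cwPort := some (decide (h.count true < h.count false))
  terminated := false

lemma portId_le_portId_true (i : ℕ) (p : Port) : portId i p ≤ portId i true := by
  cases p <;> simp [portId]

lemma portId_le_portId {i j : ℕ} (hij : i < j) (p q : Port) : portId i p ≤ portId j q := by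
  have := p.toNat_le
  unfold portId
  omega

lemma forwarded_succ (k r : ℕ) :
    forwarded k (r + 1) = forwarded k r + if r + 1 ≠ k then 1 else 0 := by
  unfold forwarded
  split_ifs <;> omega

lemma le_forwarded (k r : ℕ) : r ≤ forwarded k r := by
  unfold forwarded
  split_ifs <;> omega

lemma forwarded_le {k r m : ℕ} (hk : k ≤ m) (hr : r ≤ m) : forwarded k r ≤ m := by
  unfold forwarded
  split_ifs <;> omega

lemma le_of_forwarded_eq {k r : ℕ} (h : forwarded k r = r) : k ≤ r := by
  unfold forwarded at h
  split_ifs at h <;> omega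

lemma eq_of_forwarded_eq {ι : Type*} [Finite ι] {σ : Equiv.Perm ι}
    (hσ : ∀ u v, ∃ j : ℕ, σ^[j] u = v) {k f : ι → ℕ} {l : ι}
    (hf : ∀ v, f v = forwarded (k (σ v)) (f (σ v))) (hle : ∀ v, f v ≤ k l) (v : ι) :
    f v = k l := by
  -- The counters never decrease along the flow, so they are constant around the cycle; then every
  -- node has absorbed its pulse, which forces the common value up to the largest identifier.
  cases nonempty_fintype ι
  have hσf : ∀ v, f (σ v) = f v := fun v =>
    (Finset.sum_eq_sum_iff_of_le fun v _ => (le_forwarded _ _).trans_eq (hf v).symm).1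
      (Equiv.sum_comp σ f) v (Finset.mem_univ v)
  have hconst : ∀ u v, f u = f v := by
    intro u v
    obtain ⟨j, rfl⟩ := hσ u v
    have : Function.Semiconj f σ id := hσf
    simpa using ((this.iterate_right j).eq u).symm
  have habsorbed : k l ≤ f l := by
    obtain ⟨u, rfl⟩ := σ.surjective l
    exact le_of_forwarded_eq ((hf u).symm.trans (hσf u).symm)
  exact le_antisymm (hle v) (hconst v l ▸ habsorbed)

lemma totalSent_countingAct (i : ℕ) (h : List Port) (q : Port) :
    totalSent (countingAct i) h q = forwarded (portId i (!q)) (h.count (!q)) := by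
  induction h with
  | nil => simp [totalSent, countingAct, forwarded, portId]
  | cons p h ih =>
    rw [totalSent, ih]
    by_cases hq : q = !p
    · subst hq
      simp [countingAct, forwarded_succ]
    · obtain rfl : q = p := by simpa using Bool.eq_not_of_ne hq
      simp [countingAct]

section Outcome

variable {h : List Port} {p : Port} {m : ℕ}

lemma countingAct_role (hp : h.count p = portId m true) (hnp : h.count (!p) = portId m false)
    (i : ℕ) :
    (countingAct i h).role = if m = i then some Role.leader else some Role.nonLeader := by
  have hmax : max (h.count false) (h.count true) = portId m true := by
    cases p <;> simp_all [portId]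
  simp [countingAct, hmax, portId]

lemma countingAct_cwPort (hp : h.count p = portId m true) (hnp : h.count (!p) = portId m false)
    (i : ℕ) : (countingAct i h).cwPort = some (!p) := by
  cases p <;> simp_all [countingAct, portId]

end Outcome

/-- The value of `X` is almost surely determined by finitely many coin flips of the tape. -/
def DependsOnFinitelyManyCoins {α : Type*} (X : Tape → α) : Prop :=
  ∀ᵐ ω ∂tapeLaw, ∃ k : ℕ, ∀ ω' : Tape, (∀ i < k, ω' i = ω i) → X ω' = X ω

/-- The pulse-counting algorithm in which a node with tape `ω` takes the identifier `X ω`. -/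
def counting (X : Tape → ℕ) (hX : DependsOnFinitelyManyCoins X) : Algorithm where
  act ω := countingAct (X ω)
  finitely_many_coins h := hX.mono fun _ ⟨k, hk⟩ => ⟨k, fun ω' hω' => by rw [hk ω' hω']⟩

variable {X : Tape → ℕ} {hX : DependsOnFinitelyManyCoins X}

lemma counting_neverTerminates : (counting X hX).NeverTerminates := fun _ _ => rfl

variable {n : ℕ} [NeZero n] {o : ZMod n → Port} {ω : ZMod n → Tape} {e : ℕ → Config n}

lemma transit_add_count_inPort (he : (counting X hX).IsExecution o ω e) (t : ℕ) (b : Bool)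
    (v : ZMod n) :
    (e t).transit (v, inPort o b v) + ((e t).hist v).count (inPort o b v) =
      forwarded (portId (X (ω (upstream b v))) (inPort o b (upstream b v)))
        (((e t).hist (upstream b v)).count (inPort o b (upstream b v))) := by
  have := he.transit_add_count counting_neverTerminates t (v, inPort o b v)
  simpa only [link_inPort, counting, totalSent_countingAct, Bool.not_not] using this

lemma count_inPort_le (he : (counting X hX).IsExecution o ω e) {b : Bool} {m : ℕ}
    (hm : ∀ v, portId (X (ω v)) (inPort o b v) ≤ m) (t : ℕ) (v : ZMod n) :
    ((e t).hist v).count (inPort o b v) ≤ m := by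
  induction t generalizing v with
  | zero => simp [he.1, Algorithm.start]
  | succ t ih =>
    calc ((e (t + 1)).hist v).count (inPort o b v)
        ≤ (e t).transit (v, inPort o b v) + ((e t).hist v).count (inPort o b v) :=
          he.count_hist_succ_le counting_neverTerminates t (v, inPort o b v)
      _ ≤ m := (transit_add_count_inPort he t b v).trans_le (forwarded_le (hm _) (ih _))

lemma count_hist_le (he : (counting X hX).IsExecution o ω e) {m : ℕ}
    (hm : ∀ v, portId (X (ω v)) true ≤ m) (t : ℕ) (v : ZMod n) (p : Port) :
    ((e t).hist v).count p ≤ m := by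
  obtain ⟨b, rfl⟩ := exists_inPort_eq o v p
  exact count_inPort_le he (fun u => (portId_le_portId_true _ _).trans (hm u)) t v

lemma sent_le (he : (counting X hX).IsExecution o ω e) {m : ℕ}
    (hm : ∀ v, portId (X (ω v)) true ≤ m) (t : ℕ) : (e t).sent ≤ n * (2 * m) := by
  rw [he.sent_eq counting_neverTerminates]
  calc ∑ v, ∑ q, totalSent (countingAct (X (ω v))) ((e t).hist v) q
      ≤ ∑ _v : ZMod n, ∑ _q : Port, m := by
        gcongr with v _ q _
        rw [totalSent_countingAct]
        exact forwarded_le ((portId_le_portId_true _ _).trans (hm v)) (count_hist_le he hm t v _)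
    _ = n * (2 * m) := by simp [ZMod.card]

lemma exists_quiescent (he : (counting X hX).IsExecution o ω e) : ∃ t, (e t).Quiescent := by
  obtain ⟨m, hm⟩ := (Set.finite_range fun v => portId (X (ω v)) true).bddAbove
  have hm' : ∀ v, portId (X (ω v)) true ≤ m := fun v => hm ⟨v, rfl⟩
  refine he.exists_quiescent_of_length_hist_le counting_neverTerminates (m := m + m) fun t v => ?_
  rw [← List.count_true_add_count_false]
  exact add_le_add (count_hist_le he hm' t v true) (count_hist_le he hm' t v false)

lemma count_inPort_eq_of_quiescent (he : (counting X hX).IsExecution o ω e) {t : ℕ}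
    (ht : (e t).Quiescent) {b : Bool} {l : ZMod n}
    (hl : ∀ v, portId (X (ω v)) (inPort o b v) ≤ portId (X (ω l)) (inPort o b l)) (v : ZMod n) :
    ((e t).hist v).count (inPort o b v) = portId (X (ω l)) (inPort o b l) := by
  refine eq_of_forwarded_eq (exists_iterate_upstream_eq b)
    (k := fun v => portId (X (ω v)) (inPort o b v))
    (f := fun v => ((e t).hist v).count (inPort o b v)) (fun v => ?_) (count_inPort_le he hl t) v
  simpa only [ht _, zero_add] using transit_add_count_inPort he t b v

/-- The values of `x` have a unique maximum, and it is less than `B`. -/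
def HasUniqueMaxLT {ι α : Type*} [LT α] (x : ι → α) (B : α) : Prop :=
  ∃ l, (∀ v, v ≠ l → x v < x l) ∧ x l < B

lemma succeeds_of_hasUniqueMaxLT (he : (counting X hX).IsExecution o ω e) {B : ℕ}
    (hB : HasUniqueMaxLT (fun v => X (ω v)) B) :
    (counting X hX).Succeeds o ω e (n * (4 * B)) := by
  obtain ⟨l, hl, hlB : X (ω l) < B⟩ := hB
  have hmax (b) (v) : portId (X (ω v)) (inPort o b v) ≤ portId (X (ω l)) (inPort o b l) := by
    rcases eq_or_ne v l with rfl | hv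
    · rfl
    · exact portId_le_portId (hl v hv) _ _
  obtain ⟨t, ht⟩ := exists_quiescent he
  -- The direction that reaches Port 1 of the leader is the clockwise one: every node receives one
  -- more pulse from it than from the other direction.
  obtain ⟨b, hb⟩ := exists_inPort_eq o l true
  have hcw (v) : ((e t).hist v).count (inPort o b v) = portId (X (ω l)) true := by
    rw [count_inPort_eq_of_quiescent he ht (hmax b), hb]
  have hccw (v) : ((e t).hist v).count (!inPort o b v) = portId (X (ω l)) false := by
    rw [← inPort_not, count_inPort_eq_of_quiescent he ht (hmax !b), inPort_not, hb, Bool.not_true]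
  have hsent : (e t).sent ≤ n * (4 * B) := by
    have hid (v) : portId (X (ω v)) true ≤ 2 * B := by
      have : X (ω v) ≤ X (ω l) := by
        rcases eq_or_ne v l with rfl | hv
        exacts [le_rfl, (hl v hv).le]
      simp only [portId, Bool.toNat_true]
      omega
    exact (sent_le he hid t).trans_eq (by ring)
  refine ⟨t, ht, mod_cast hsent, ⟨l, ?_, fun v hv => ?_⟩, _, fun v => ?_,
    isOrientation_not_inPort o b⟩
  · exact (countingAct_role (hcw l) (hccw l) _).trans (if_pos rfl)
  · exact (countingAct_role (hcw v) (hccw v) _).trans (if_neg (hl v hv).ne')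
  · exact countingAct_cwPort (hcw v) (hccw v) _

end PulseCounting

section UniqueMaximum

lemma hasUniqueMaxLT_of_eq_imp_lt {ι α : Type*} [Finite ι] [LinearOrder α] {x : ι → α} {a B : α}
    {w : ι} (hw : a ≤ x w) (hcollision : ∀ u v, u ≠ v → x u = x v → x u < a) (hB : ∀ v, x v < B) :
    HasUniqueMaxLT x B := by
  have : Nonempty ι := ⟨w⟩
  obtain ⟨l, hl⟩ := Finite.exists_max x
  refine ⟨l, fun v hv => (hl v).lt_of_ne fun heq => ?_, hB l⟩
  exact (hcollision v l hv heq).not_ge (hw.trans (heq ▸ hl w))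

variable {Ω ι α : Type*} [MeasurableSpace Ω] {μ : Measure Ω} [MeasurableSpace α]
  [DiscreteMeasurableSpace α]

lemma measure_eq_and_le_le_of_indepFun [IsProbabilityMeasure μ] [Countable α] [Preorder α]
    {X Y : Ω → α} (hY : Measurable Y) (hXY : IndepFun X Y μ) {a : α} {ε : ℝ≥0∞}
    (hε : ∀ m, a ≤ m → μ {ω | X ω = m} ≤ ε) : μ {ω | X ω = Y ω ∧ a ≤ X ω} ≤ ε := by
  have hsub : {ω | X ω = Y ω ∧ a ≤ X ω} ⊆ ⋃ m ∈ Set.Ici a, X ⁻¹' {m} ∩ Y ⁻¹' {m} := fun ω hω =>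
    Set.mem_biUnion hω.2 ⟨rfl, hω.1.symm⟩
  calc μ {ω | X ω = Y ω ∧ a ≤ X ω}
      ≤ ∑' m : Set.Ici a, μ (X ⁻¹' {m.1} ∩ Y ⁻¹' {m.1}) :=
        (measure_mono hsub).trans (measure_biUnion_le μ (Set.to_countable _) _)
    _ = ∑' m : Set.Ici a, μ (X ⁻¹' {m.1}) * μ (Y ⁻¹' {m.1}) := by
        simp only [hXY.measure_inter_preimage_eq_mul _ _ (.of_discrete) (.of_discrete)]
    _ ≤ ∑' m : Set.Ici a, ε * μ (Y ⁻¹' {m.1}) := by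
        gcongr with m
        exact hε m m.2
    _ = ε * μ (Y ⁻¹' Set.Ici a) := by
        rw [ENNReal.tsum_mul_left, tsum_measure_preimage_singleton (Set.to_countable _)
          fun m _ => hY .of_discrete]
    _ ≤ ε := mul_le_of_le_one_right' prob_le_one

variable [Fintype ι] {X : ι → Ω → α} {a B : α} {p q ε : ℝ≥0∞}

lemma measure_forall_lt_le_of_iIndepFun [Preorder α] (hX : iIndepFun X μ)
    (hp : ∀ v, μ {ω | X v ω < a} ≤ p) :
    μ {ω | ∀ v, X v ω < a} ≤ p ^ Fintype.card ι := by
  have heq : {ω | ∀ v, X v ω < a} = ⋂ v ∈ Finset.univ, X v ⁻¹' Set.Iio a := by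
    ext
    simp
  rw [heq, hX.measure_inter_preimage_eq_mul Finset.univ fun _ _ => .of_discrete]
  exact (Finset.prod_le_prod' fun v _ => hp v).trans_eq (by simp)

lemma measure_not_hasUniqueMaxLT_le [IsProbabilityMeasure μ] [Countable α] [LinearOrder α]
    (hm : ∀ v, Measurable (X v)) (hX : iIndepFun X μ) (hp : ∀ v, μ {ω | X v ω < a} ≤ p)
    (hε : ∀ v m, a ≤ m → μ {ω | X v ω = m} ≤ ε) (hq : ∀ v, μ {ω | B ≤ X v ω} ≤ q) :
    μ {ω | ¬ HasUniqueMaxLT (fun v => X v ω) B} ≤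
      p ^ Fintype.card ι + Fintype.card ι ^ 2 * ε + Fintype.card ι * q := by
  let allSmall : Set Ω := {ω | ∀ v, X v ω < a}
  let collision (x : ι × ι) : Set Ω := {ω | x.1 ≠ x.2 ∧ X x.1 ω = X x.2 ω ∧ a ≤ X x.1 ω}
  let tooLarge (v : ι) : Set Ω := {ω | B ≤ X v ω}
  have hsub : {ω | ¬ HasUniqueMaxLT (fun v => X v ω) B} ⊆
      allSmall ∪ (⋃ x, collision x) ∪ ⋃ v, tooLarge v := by
    intro ω hω
    by_contra hgood
    simp only [allSmall, collision, tooLarge, Set.mem_union, Set.mem_iUnion, Set.mem_ofPred_eq,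
      Prod.exists, not_or, not_exists, not_forall, not_and, not_le, not_lt] at hgood
    obtain ⟨⟨⟨w, hw⟩, hcollision⟩, hB⟩ := hgood
    exact hω (hasUniqueMaxLT_of_eq_imp_lt hw hcollision hB)
  have hcollision (x : ι × ι) : μ (collision x) ≤ ε := by
    by_cases hx : x.1 = x.2
    · simp [collision, hx]
    · exact (measure_mono fun ω hω => hω.2).trans
        (measure_eq_and_le_le_of_indepFun (hm _) (hX.indepFun hx) (hε x.1))
  calc μ {ω | ¬ HasUniqueMaxLT (fun v => X v ω) B}
      ≤ μ allSmall + ∑ x, μ (collision x) + ∑ v, μ (tooLarge v) := by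
        grw [hsub, measure_union_le, measure_union_le, measure_iUnion_fintype_le,
          measure_iUnion_fintype_le]
    _ ≤ p ^ Fintype.card ι + ∑ _x : ι × ι, ε + ∑ _v : ι, q := by
        gcongr with x _ v _
        exacts [measure_forall_lt_le_of_iIndepFun hX hp, hcollision x, hq v]
    _ = p ^ Fintype.card ι + Fintype.card ι ^ 2 * ε + Fintype.card ι * q := by simp [sq]

end UniqueMaximum

section RandomIdentifiers

/-- The number of tails before the first head of a tape, and `0` if the tape has no head. -/
noncomputable def firstHead (ω : Tape) : ℕ := sInf {j | ω j = true}

/-- The number whose binary digits are the first `l` coin flips, preceded by a leading digit `1`,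
so that the number determines `l`. -/
def prefixCode (l : ℕ) (ω : Tape) : ℕ := 2 ^ l + Nat.ofBits (fun j : Fin l => ω j)

/-- The random identifier of a node: it encodes a prefix of the tape whose length is `K` times the
(geometrically distributed) number of flips up to the first head. -/
noncomputable def randomId (K : ℕ) (ω : Tape) : ℕ := prefixCode (K * (firstHead ω + 1)) ω

lemma apply_firstHead {ω : Tape} (h : ∃ j, ω j = true) : ω (firstHead ω) = true := Nat.sInf_mem h

lemma le_firstHead_iff {ω : Tape} (h : ∃ j, ω j = true) (l : ℕ) :
    l ≤ firstHead ω ↔ ∀ j < l, ω j = false := by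
  refine ⟨fun hl j hj => ?_, fun hl => not_lt.1 fun hlt => ?_⟩
  · simpa using Nat.notMem_of_lt_sInf (hj.trans_le hl)
  · simpa [apply_firstHead h] using hl _ hlt

lemma firstHead_congr {ω ω' : Tape} (h : ∃ j, ω j = true) (hω' : ∀ j ≤ firstHead ω, ω' j = ω j) :
    firstHead ω' = firstHead ω := by
  have hhead : ω' (firstHead ω) = true := (hω' _ le_rfl).trans (apply_firstHead h)
  refine le_antisymm (Nat.sInf_le hhead) ((le_firstHead_iff ⟨_, hhead⟩ _).2 fun j hj => ?_)
  exact (hω' j hj.le).trans ((le_firstHead_iff h _).1 le_rfl j hj)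

lemma two_pow_le_prefixCode (l : ℕ) (ω : Tape) : 2 ^ l ≤ prefixCode l ω := Nat.le_add_right _ _

lemma prefixCode_lt_two_pow (l : ℕ) (ω : Tape) : prefixCode l ω < 2 ^ (l + 1) := by
  have := Nat.ofBits_lt_two_pow (fun j : Fin l => ω j)
  unfold prefixCode
  omega

lemma testBit_prefixCode {l j : ℕ} (hj : j < l) (ω : Tape) : (prefixCode l ω).testBit j = ω j := by
  rw [prefixCode, Nat.testBit_two_pow_add_gt hj, Nat.testBit_ofBits_lt _ _ hj]

lemma prefixCode_congr {l : ℕ} {ω ω' : Tape} (h : ∀ j < l, ω' j = ω j) :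
    prefixCode l ω' = prefixCode l ω := by
  simp only [prefixCode, h _ (Fin.is_lt _)]

lemma measurable_firstHead : Measurable firstHead := by
  refine measurable_of_Ici fun l => ?_
  rcases l.eq_zero_or_pos with rfl | hl
  · simp
  have heq : firstHead ⁻¹' Set.Ici l =
      {ω | ∃ j, ω j = true} ∩ {ω | ∀ j < l, ω j = false} := by
    ext ω
    refine ⟨fun h => ?_, fun ⟨hhead, htails⟩ => (le_firstHead_iff hhead l).2 htails⟩
    have hhead := Nat.nonempty_of_pos_sInf (hl.trans_le h)
    exact ⟨hhead, (le_firstHead_iff hhead l).1 h⟩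
  rw [heq]
  measurability

lemma measurable_prefixCode (l : ℕ) : Measurable (prefixCode l) :=
  (measurable_of_countable fun f : Fin l → Bool => 2 ^ l + Nat.ofBits f).comp <|
    measurable_pi_lambda _ fun _ => measurable_pi_apply _

lemma measurable_randomId (K : ℕ) : Measurable (randomId K) := by
  have h : Measurable fun x : ℕ × Tape => prefixCode (K * (x.1 + 1)) x.2 :=
    measurable_from_prod_countable_right fun g => measurable_prefixCode (K * (g + 1))
  exact h.comp (measurable_firstHead.prodMk measurable_id)

lemma fairCoin_singleton (b : Bool) : fairCoin {b} = 2⁻¹ := by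
  simp [fairCoin, PMF.uniformOfFintype_apply]

lemma tapeLaw_forall_lt_eq (l : ℕ) (f : ℕ → Bool) :
    tapeLaw {ω | ∀ j < l, ω j = f j} = 2⁻¹ ^ l := by
  have : {ω : Tape | ∀ j < l, ω j = f j} = Set.pi (Finset.range l : Set ℕ) fun j => {f j} := by
    ext ω
    simp [Set.mem_pi]
  rw [this, tapeLaw, Measure.infinitePi_pi _ fun _ _ => measurableSet_singleton _]
  simp [fairCoin_singleton]

lemma ae_exists_head : ∀ᵐ ω ∂tapeLaw, ∃ j, ω j = true := by
  have hle (l : ℕ) : tapeLaw {ω | ¬ ∃ j, ω j = true} ≤ 2⁻¹ ^ l := by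
    rw [← tapeLaw_forall_lt_eq l fun _ => false]
    exact measure_mono fun ω hω j _ => by simpa using not_exists.1 hω j
  exact le_zero_iff.1 <| ge_of_tendsto'
    (ENNReal.tendsto_pow_atTop_nhds_zero_of_lt_one ENNReal.one_half_lt_one) hle

lemma dependsOnFinitelyManyCoins_randomId (K : ℕ) : DependsOnFinitelyManyCoins (randomId K) := by
  filter_upwards [ae_exists_head] with ω hω
  refine ⟨(K + 1) * (firstHead ω + 1), fun ω' hω' => ?_⟩
  rw [randomId, randomId, firstHead_congr hω fun j hj => hω' j (by nlinarith)]
  exact prefixCode_congr fun j hj => hω' j (by nlinarith)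

lemma tapeLaw_le_firstHead (l : ℕ) : tapeLaw {ω | l ≤ firstHead ω} = 2⁻¹ ^ l := by
  rw [← tapeLaw_forall_lt_eq l fun _ => false]
  refine measure_congr ?_
  filter_upwards [ae_exists_head] with ω hω
  exact propext (le_firstHead_iff hω l)

lemma tapeLaw_firstHead_lt (l : ℕ) : tapeLaw {ω | firstHead ω < l} = 1 - 2⁻¹ ^ l := by
  have hmeas : MeasurableSet {ω | l ≤ firstHead ω} := measurable_firstHead measurableSet_Ici
  rw [← tapeLaw_le_firstHead, ← prob_compl_eq_one_sub hmeas]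
  simp only [Set.compl_ofPred, not_le]

lemma tapeLaw_randomId_lt (K l : ℕ) :
    tapeLaw {ω | randomId K ω < 2 ^ (K * (l + 1))} ≤ 1 - 2⁻¹ ^ l := by
  rw [← tapeLaw_firstHead_lt]
  refine measure_mono fun ω (hω : randomId K ω < _) => ?_
  have : K * (firstHead ω + 1) < K * (l + 1) :=
    (Nat.pow_lt_pow_iff_right one_lt_two).1 ((two_pow_le_prefixCode _ ω).trans_lt hω)
  exact Nat.lt_of_add_lt_add_right (Nat.lt_of_mul_lt_mul_left this)

lemma tapeLaw_le_randomId (K l : ℕ) :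
    tapeLaw {ω | 2 ^ (K * l + 1) ≤ randomId K ω} ≤ 2⁻¹ ^ l := by
  rw [← tapeLaw_le_firstHead]
  refine measure_mono fun ω (hω : _ ≤ randomId K ω) => ?_
  have : K * l + 1 < K * (firstHead ω + 1) + 1 :=
    (Nat.pow_lt_pow_iff_right one_lt_two).1 (hω.trans_lt (prefixCode_lt_two_pow _ ω))
  exact Nat.le_of_lt_succ (Nat.lt_of_mul_lt_mul_left (Nat.lt_of_add_lt_add_right this))

lemma tapeLaw_randomId_eq_le (K : ℕ) {m l : ℕ} (hm : 2 ^ l ≤ m) :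
    tapeLaw {ω | randomId K ω = m} ≤ 2⁻¹ ^ l := by
  rw [← tapeLaw_forall_lt_eq l m.testBit]
  refine measure_mono fun ω (hω : randomId K ω = m) j hj => ?_
  have hl : l < K * (firstHead ω + 1) + 1 :=
    (Nat.pow_lt_pow_iff_right one_lt_two).1 ((hm.trans_eq hω.symm).trans_lt
      (prefixCode_lt_two_pow _ ω))
  rw [← hω, randomId, testBit_prefixCode (by omega)]

lemma ringLaw_not_hasUniqueMaxLT_randomId_le (n : ℕ) [NeZero n] (K a b : ℕ) :
    ringLaw n {ω | ¬ HasUniqueMaxLT (fun v => randomId K (ω v)) (2 ^ (K * b + 1))} ≤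
      (1 - 2⁻¹ ^ a) ^ n + n ^ 2 * 2⁻¹ ^ (K * (a + 1)) + n * 2⁻¹ ^ b := by
  have : IsProbabilityMeasure (ringLaw n) := by
    unfold ringLaw
    infer_instance
  have hlaw (v : ZMod n) (S : Set ℕ) :
      ringLaw n {ω | randomId K (ω v) ∈ S} = tapeLaw {τ | randomId K τ ∈ S} :=
    (measurePreserving_eval (fun _ => tapeLaw) v).measure_preimage
      (measurable_randomId K .of_discrete).nullMeasurableSet
  have hindep : iIndepFun (fun v ω => randomId K (ω v)) (ringLaw n) :=
    iIndepFun_pi fun _ => (measurable_randomId K).aemeasurable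
  simpa only [ZMod.card, Function.comp_apply] using measure_not_hasUniqueMaxLT_le
    (fun v => (measurable_randomId K).comp (measurable_pi_apply v)) hindep
    (fun v => (hlaw v (Set.Iio _)).trans_le (tapeLaw_randomId_lt K a))
    (fun v m hm => (hlaw v {m}).trans_le (tapeLaw_randomId_eq_le K hm))
    (fun v => (hlaw v (Set.Ici _)).trans_le (tapeLaw_le_randomId K b))

end RandomIdentifiers

section PolynomialBounds

open Real

lemma four_pow_log_le {n : ℕ} (hn : n ≠ 0) : (4 : ℝ) ^ Nat.log 4 n ≤ n := by
  exact_mod_cast Nat.pow_log_le_self 4 hn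

lemma le_four_pow_log_add_one (n : ℕ) : (n : ℝ) ≤ 4 ^ (Nat.log 4 n + 1) := by
  exact_mod_cast (Nat.lt_pow_succ_log_self (by norm_num) n).le

lemma two_pow_mul_log_add_one_le {n : ℕ} (hn : n ≠ 0) (e : ℕ) :
    (2 : ℝ) ^ (2 * e * (Nat.log 4 n + 1)) ≤ (4 * n) ^ e := by
  calc (2 : ℝ) ^ (2 * e * (Nat.log 4 n + 1)) = (4 * 4 ^ Nat.log 4 n) ^ e := by
        rw [← pow_succ', ← pow_mul, show (4 : ℝ) = 2 ^ 2 by norm_num, ← pow_mul]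
        ring_nf
    _ ≤ (4 * n) ^ e := by
        gcongr
        exact four_pow_log_le hn

lemma mul_inv_two_pow_mul_log_add_one_le {n : ℕ} (hn : n ≠ 0) (d e : ℕ) :
    (n : ℝ) ^ e * 2⁻¹ ^ (2 * (d + e) * (Nat.log 4 n + 1)) ≤ ((n : ℝ) ^ d)⁻¹ := by
  have hpow : (2 : ℝ) ^ (2 * (d + e) * (Nat.log 4 n + 1)) = (4 ^ (Nat.log 4 n + 1)) ^ (d + e) := by
    rw [← pow_mul, show (4 : ℝ) = 2 ^ 2 by norm_num, ← pow_mul]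
    ring_nf
  calc (n : ℝ) ^ e * 2⁻¹ ^ (2 * (d + e) * (Nat.log 4 n + 1))
      ≤ (n : ℝ) ^ e * ((n : ℝ) ^ (d + e))⁻¹ := by
        rw [inv_pow, hpow]
        gcongr
        exact le_four_pow_log_add_one n
    _ = ((n : ℝ) ^ d)⁻¹ := by
        rw [pow_add]
        field_simp

lemma exp_neg_le_factorial_div_pow {x : ℝ} (hx : 0 < x) (k : ℕ) :
    exp (-x) ≤ k.factorial / x ^ k := by
  rw [exp_neg, ← inv_div]
  exact inv_anti₀ (by positivity) (pow_div_factorial_le_exp x hx.le k)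

lemma one_sub_inv_two_pow_log_pow_le {n : ℕ} (hn : n ≠ 0) (d : ℕ) :
    (1 - (2⁻¹ : ℝ) ^ Nat.log 4 n) ^ n ≤ (2 * d).factorial * 4 ^ d * ((n : ℝ) ^ d)⁻¹ := by
  set a := Nat.log 4 n
  have hn' : (0 : ℝ) < n := by positivity
  have hsq : (4 : ℝ) ^ a = 2 ^ a * 2 ^ a := by
    rw [← mul_pow]
    norm_num
  have hle : (2 : ℝ) ^ a * 2 ^ a ≤ n := hsq ▸ four_pow_log_le hn
  have hdiv : (2 : ℝ) ^ a / n ≤ 2⁻¹ ^ a := by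
    rw [inv_pow, div_le_iff₀ hn', ← div_eq_inv_mul, le_div_iff₀ (by positivity)]
    exact hle
  have hn4 : (n : ℝ) / 4 ≤ (2 ^ a) ^ 2 := by
    have := le_four_pow_log_add_one n
    rw [sq, ← hsq]
    linarith [pow_succ (4 : ℝ) a]
  calc (1 - (2⁻¹ : ℝ) ^ a) ^ n ≤ (1 - 2 ^ a / n) ^ n := by
        gcongr
        exact sub_nonneg.2 (pow_le_one₀ (by norm_num) (by norm_num))
    _ ≤ exp (-2 ^ a) :=
        one_sub_div_pow_le_exp_neg ((le_mul_of_one_le_left (by positivity)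
          (one_le_pow₀ one_le_two)).trans hle)
    _ ≤ (2 * d).factorial / ((2 ^ a) ^ 2) ^ d := by
        rw [← pow_mul]
        exact exp_neg_le_factorial_div_pow (by positivity) _
    _ ≤ (2 * d).factorial / (n / 4) ^ d := by gcongr
    _ = (2 * d).factorial * 4 ^ d * ((n : ℝ) ^ d)⁻¹ := by
        rw [div_pow]
        field_simp

lemma failure_bound_le {n : ℕ} (hn : n ≠ 0) (d : ℕ) :
    (1 - (2⁻¹ : ℝ≥0∞) ^ Nat.log 4 n) ^ n +
        n ^ 2 * 2⁻¹ ^ (2 * (d + 2) * (Nat.log 4 n + 1)) +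
        n * 2⁻¹ ^ (2 * (d + 1) * (Nat.log 4 n + 1)) ≤
      ENNReal.ofReal (((2 * d).factorial * 4 ^ d + 2) * ((n : ℝ) ^ d)⁻¹) := by
  have hsmall := one_sub_inv_two_pow_log_pow_le hn d
  have hcollision := mul_inv_two_pow_mul_log_add_one_le hn d 2
  have hlarge := mul_inv_two_pow_mul_log_add_one_le hn d 1
  have htwo : (2⁻¹ : ℝ≥0∞) = ENNReal.ofReal 2⁻¹ := by
    rw [ENNReal.ofReal_inv_of_pos two_pos, ENNReal.ofReal_ofNat]
  have hsub : (0 : ℝ) ≤ 1 - 2⁻¹ ^ Nat.log 4 n :=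
    sub_nonneg.2 (pow_le_one₀ (by norm_num) (by norm_num))
  calc _ = ENNReal.ofReal ((1 - (2⁻¹ : ℝ) ^ Nat.log 4 n) ^ n +
        n ^ 2 * 2⁻¹ ^ (2 * (d + 2) * (Nat.log 4 n + 1)) +
        n ^ 1 * 2⁻¹ ^ (2 * (d + 1) * (Nat.log 4 n + 1))) := by
        rw [htwo, ENNReal.ofReal_add (by positivity) (by positivity),
          ENNReal.ofReal_add (by positivity) (by positivity), ENNReal.ofReal_pow hsub,
          ENNReal.ofReal_sub _ (by positivity), ENNReal.ofReal_mul (by positivity),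
          ENNReal.ofReal_mul (by positivity)]
        simp only [ENNReal.ofReal_pow, inv_nonneg, Nat.ofNat_nonneg, Nat.cast_nonneg,
          ENNReal.ofReal_natCast, ENNReal.ofReal_one, pow_one]
    _ ≤ _ := ENNReal.ofReal_le_ofReal (by linarith)

lemma pulse_bound_le {n : ℕ} (hn : n ≠ 0) (K e : ℕ) :
    (n : ℝ) * (4 * 2 ^ (K * (2 * e * (Nat.log 4 n + 1)) + 1)) ≤
      8 * 4 ^ (K * e) * (n : ℝ) ^ (K * e + 1) := by
  calc (n : ℝ) * (4 * 2 ^ (K * (2 * e * (Nat.log 4 n + 1)) + 1))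
      = 8 * n * (2 ^ (2 * e * (Nat.log 4 n + 1))) ^ K := by ring
    _ ≤ 8 * n * ((4 * n) ^ e) ^ K := by
        gcongr
        exact two_pow_mul_log_add_one_le hn e
    _ = 8 * 4 ^ (K * e) * (n : ℝ) ^ (K * e + 1) := by ring

lemma inv_pow_le_rpow_neg {x c : ℝ} (hx : 1 ≤ x) {d : ℕ} (hd : c ≤ d) : (x ^ d)⁻¹ ≤ x ^ (-c) := by
  rw [← rpow_natCast, ← rpow_neg (by positivity)]
  exact rpow_le_rpow_of_exponent_le hx (neg_le_neg hd)

end PolynomialBounds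

section RandomCounting

lemma Algorithm.Succeeds.mono {n : ℕ} [NeZero n] {A : Algorithm} {o : ZMod n → Port}
    {ω : ZMod n → Tape} {e : ℕ → Config n} {B B' : ℝ} (h : A.Succeeds o ω e B) (hB : B ≤ B') :
    A.Succeeds o ω e B' :=
  let ⟨t, ht, hsent, houtput⟩ := h
  ⟨t, ht, hsent.trans hB, houtput⟩

/-- The pulse-counting algorithm with random identifiers; the larger `K` is, the smaller is its
failure probability. -/
noncomputable def randomCounting (K : ℕ) : Algorithm :=
  counting (randomId K) (dependsOnFinitelyManyCoins_randomId K)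

lemma randomCounting_succeeds {n : ℕ} [NeZero n] {o : ZMod n → Port} {ω : ZMod n → Tape}
    {e : ℕ → Config n} {K d : ℕ} (he : (randomCounting K).IsExecution o ω e)
    (hω : HasUniqueMaxLT (fun v => randomId K (ω v))
      (2 ^ (K * (2 * d * (Nat.log 4 n + 1)) + 1))) :
    (randomCounting K).Succeeds o ω e (8 * 4 ^ (K * d) * (n : ℝ) ^ (K * d + 1)) := by
  refine (succeeds_of_hasUniqueMaxLT he hω).mono ?_
  rw [Nat.cast_pow, Nat.cast_ofNat]
  exact pulse_bound_le (NeZero.ne n) K d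

lemma ringLaw_not_randomCounting_succeeds_le {n : ℕ} [NeZero n] (o : ZMod n → Port) (d : ℕ) :
    let K := 2 * (d + 2)
    ringLaw n {ω | ¬ ∀ e, (randomCounting K).IsExecution o ω e →
        (randomCounting K).Succeeds o ω e
          (8 * 4 ^ (K * (d + 1)) * (n : ℝ) ^ (K * (d + 1) + 1))} ≤
      ENNReal.ofReal (((2 * d).factorial * 4 ^ d + 2) * ((n : ℝ) ^ d)⁻¹) := by
  intro K
  have hsub : {ω | ¬ ∀ e, (randomCounting K).IsExecution o ω e →
        (randomCounting K).Succeeds o ω e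
          (8 * 4 ^ (K * (d + 1)) * (n : ℝ) ^ (K * (d + 1) + 1))} ⊆
      {ω | ¬ HasUniqueMaxLT (fun v => randomId K (ω v))
        (2 ^ (K * (2 * (d + 1) * (Nat.log 4 n + 1)) + 1))} := fun ω hω hmax =>
    hω fun e he => randomCounting_succeeds he hmax
  exact (measure_mono hsub).trans <|
    (ringLaw_not_hasUniqueMaxLT_randomId_le n K (Nat.log 4 n) _).trans <|
    failure_bound_le (NeZero.ne n) d

end RandomCounting

end ContentOblivious

theorem mainTheorem5 (c : ℝ) (hc : 0 < c) :
    ∃ (A : ContentOblivious.Algorithm) (C : ℝ) (k : ℕ),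
      ∀ (n : ℕ) [NeZero n] (o : ZMod n → ContentOblivious.Port),
        -- with high probability, success with polynomially many pulses under every schedule
        ContentOblivious.ringLaw n
            {ω | ¬ ∀ e, A.IsExecution o ω e → A.Succeeds o ω e (C * (n : ℝ) ^ k)}
          ≤ ENNReal.ofReal (C * (n : ℝ) ^ (-c)) ∧
        -- quiescence is reached almost surely, under every schedule
        (∀ᵐ ω ∂(ContentOblivious.ringLaw n), ∀ e, A.IsExecution o ω e → ∃ t, (e t).Quiescent) ∧
        -- no node ever terminates
        (∀ ω e, A.IsExecution o ω e → ∀ t v, (A.current ω (e t) v).terminated = false) := by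
  open ContentOblivious in
  obtain ⟨d, hd⟩ := exists_nat_ge c
  let K := 2 * (d + 2)
  let C₁ : ℝ := (2 * d).factorial * 4 ^ d + 2
  let C₂ : ℝ := 8 * 4 ^ (K * (d + 1))
  refine ⟨randomCounting K, max C₁ C₂, K * (d + 1) + 1, fun n _ o => ⟨?_, ?_, ?_⟩⟩
  · have hn : (1 : ℝ) ≤ n := mod_cast NeZero.one_le
    calc ringLaw n {ω | ¬ ∀ e, (randomCounting K).IsExecution o ω e →
          (randomCounting K).Succeeds o ω e (max C₁ C₂ * (n : ℝ) ^ (K * (d + 1) + 1))}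
        ≤ ringLaw n {ω | ¬ ∀ e, (randomCounting K).IsExecution o ω e →
          (randomCounting K).Succeeds o ω e (C₂ * (n : ℝ) ^ (K * (d + 1) + 1))} := by
          refine measure_mono fun ω hω h => hω fun e he => (h e he).mono ?_
          gcongr
          exact le_max_right C₁ C₂
      _ ≤ ENNReal.ofReal (C₁ * ((n : ℝ) ^ d)⁻¹) := ringLaw_not_randomCounting_succeeds_le o d
      _ ≤ ENNReal.ofReal (max C₁ C₂ * (n : ℝ) ^ (-c)) := by
          gcongr
          exacts [le_max_left C₁ C₂, inv_pow_le_rpow_neg hn hd]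
  · exact .of_forall fun ω e he => exists_quiescent he
  · exact fun ω e _ t v => counting_neverTerminates (ω v) ((e t).hist v)
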